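/- Let $p\ge 1$, let $S\in\mathbb{R}^{p\times p}$ be symmetric positive semidefinite (a sample covariance matrix) and let $\rho>0$. Write $\|\cdot\|_2$ for the spectral norm, $\|\cdot\|_F$ for the Frobenius norm, $\|A\|_1=\sum_{i,j}|A_{ij}|$, and $\preceq$ for the Loewner order on symmetric matrices. For symmetric positive definite $\Theta$ put $f(\Theta)=-\log\det\Theta+\operatorname{Tr}(S\Theta)$, and let $\Theta^*_\rho$ be the minimizer of $f(\Theta)+\rho\|\Theta\|_1$ over all symmetric positive definite $\Theta$. Set $$\alpha=\frac{1}{\|S\|_2+p\rho},\qquad \beta=\min\Big\{\frac{p-\alpha\operatorname{Tr}(S)}{\rho},\ \gamma\Big\},$$ where $$\gamma=\min\big\{\|S^{-1}\|_1,\ (p-\rho\sqrt p\,\alpha)\|S^{-1}\|_2-(p-1)\alpha\big\}$$ if $S$ is positive definite, and $$\gamma=2\big\|(S+\tfrac{\rho}{2}I)^{-1}\big\|_1-\operatorname{Tr}\big((S+\tfrac{\rho}{2}I)^{-1}\big)$$ otherwise. Let $(\Theta_t)$ be the iterates and $(\zeta_t)$ the step sizes of the G-ISTA algorithm started at a symmetric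 positive definite matrix $\Theta_0$: for a fixed $c\in(0,1)$ and arbitrary initial trial steps $\zeta_{t,0}>0$, $$\Theta_{t+1}=\eta_{\zeta_t\rho}\big(\Theta_t-\zeta_t(S-\Theta_t^{-1})\big),\qquad [\eta_\tau(X)]_{ij}=\operatorname{sgn}(X_{ij})\max(|X_{ij}|-\tau,0),$$ where $\zeta_t$ is the largest element of $\{c^j\zeta_{t,0}:j=0,1,2,\dots\}$ for which the resulting $\Theta_{t+1}$ is positive definite and $$f(\Theta_{t+1})\le f(\Theta_t)+\operatorname{Tr}\big((\Theta_{t+1}-\Theta_t)(S-\Theta_t^{-1})\big)+\frac{1}{2\zeta_t}\|\Theta_{t+1}-\Theta_t\|_F^2 .$$ The run may be infinite or stop after any number of iterations. Assume that $\alpha I\preceq\Theta_0$ and that $\zeta_t\le\alpha^2$ for all $t$. Then all iterates, including $\Theta_0$, satisfy $$\alpha I\preceq\Theta_t\preceq b'I,\qquad b'=\|\Theta^*_\rho\|_2+\|\Theta_0-\Theta^*_\rho\|_F .$$ If moreover $\Theta_0\preceq\beta I$, then $b'\le\beta+\sqrt p\,(\beta+\alpha)$. -/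

import Mathlib

open scoped MatrixOrder

noncomputable section

namespace GISTA

variable {p : ℕ}

/-- The spectral norm `‖A‖₂`: the operator norm of `A` acting on Euclidean space. -/
def specNorm (A : Matrix (Fin p) (Fin p) ℝ) : ℝ :=
  ‖Matrix.toEuclideanCLM (n := Fin p) (𝕜 := ℝ) A‖

/-- The Frobenius norm `‖A‖_F`. -/
def frobNorm (A : Matrix (Fin p) (Fin p) ℝ) : ℝ :=
  Real.sqrt (∑ i, ∑ j, A i j ^ 2)

/-- The entrywise `ℓ₁` norm `‖A‖₁ = ∑ |A i j|`, which is also `1ᵀ |A| 1`. -/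
def l1Norm (A : Matrix (Fin p) (Fin p) ℝ) : ℝ :=
  ∑ i, ∑ j, |A i j|

/-- The smooth part `f(Θ) = - log det Θ + ⟨S, Θ⟩` of the objective (used at positive definite
matrices). -/
def smoothPart (S Θ : Matrix (Fin p) (Fin p) ℝ) : ℝ :=
  -Real.log Θ.det + (S * Θ).trace

/-- The objective `f(Θ) + ρ ‖Θ‖₁`. -/
def objective (S : Matrix (Fin p) (Fin p) ℝ) (ρ : ℝ) (Θ : Matrix (Fin p) (Fin p) ℝ) : ℝ :=
  smoothPart S Θ + ρ * l1Norm Θ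

/-- `Θ` solves the `ℓ₁`-penalized maximum likelihood problem: it minimizes the objective over the
symmetric positive definite matrices. -/
def IsSolution (S : Matrix (Fin p) (Fin p) ℝ) (ρ : ℝ) (Θ : Matrix (Fin p) (Fin p) ℝ) : Prop :=
  Θ.PosDef ∧ IsMinOn (objective S ρ) {X | X.PosDef} Θ

/-- `α = 1 / (‖S‖₂ + p ρ)`. -/
def alpha (S : Matrix (Fin p) (Fin p) ℝ) (ρ : ℝ) : ℝ :=
  1 / (specNorm S + p * ρ)

open Classical in
/-- The constant `γ` that enters the definition of `β`. -/
def gamma (S : Matrix (Fin p) (Fin p) ℝ) (ρ : ℝ) : ℝ :=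
  if S.PosDef then
    min (l1Norm S⁻¹)
      ((p - ρ * Real.sqrt p * alpha S ρ) * specNorm S⁻¹ - ((p : ℝ) - 1) * alpha S ρ)
  else
    2 * l1Norm (S + (ρ / 2) • (1 : Matrix (Fin p) (Fin p) ℝ))⁻¹
      - ((S + (ρ / 2) • (1 : Matrix (Fin p) (Fin p) ℝ))⁻¹).trace

/-- `β = min {(p - α Tr S) / ρ, γ}`. -/
def beta (S : Matrix (Fin p) (Fin p) ℝ) (ρ : ℝ) : ℝ :=
  min ((p - alpha S ρ * S.trace) / ρ) (gamma S ρ)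

/-- Entrywise soft-thresholding `η_τ`. -/
def softThreshold (τ : ℝ) (X : Matrix (Fin p) (Fin p) ℝ) : Matrix (Fin p) (Fin p) ℝ :=
  Matrix.of fun i j => Real.sign (X i j) * max (|X i j| - τ) 0

/-- The quadratic model `Q_ζ(X, Y)` of the smooth part around `Y`. -/
def quadModel (S : Matrix (Fin p) (Fin p) ℝ) (ζ : ℝ) (X Y : Matrix (Fin p) (Fin p) ℝ) : ℝ :=
  smoothPart S Y + ((X - Y) * (S - Y⁻¹)).trace + 1 / (2 * ζ) * frobNorm (X - Y) ^ 2

/-- One proximal gradient step `η_{ζρ}(Θ - ζ (S - Θ⁻¹))`. -/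
def proxStep (S : Matrix (Fin p) (Fin p) ℝ) (ρ ζ : ℝ) (Θ : Matrix (Fin p) (Fin p) ℝ) :
    Matrix (Fin p) (Fin p) ℝ :=
  softThreshold (ζ * ρ) (Θ - ζ • (S - Θ⁻¹))

/-- The acceptance test of the line search for the step size `ζ` at the iterate `Θ`. -/
def Accepts (S : Matrix (Fin p) (Fin p) ℝ) (ρ : ℝ) (Θ : Matrix (Fin p) (Fin p) ℝ) (ζ : ℝ) :
    Prop :=
  (proxStep S ρ ζ Θ).PosDef ∧
    smoothPart S (proxStep S ρ ζ Θ) ≤ quadModel S ζ (proxStep S ρ ζ Θ) Θ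

/-- `Θ 0, Θ 1, …` are the iterates and `ζ 0, ζ 1, …` the step sizes of the first `N` passes
through the loop of the algorithm G-ISTA (`N = ⊤` for a run that never stops), with backtracking
constant `c` and initial trial step `ζinit t` in pass `t`. The trial steps are arbitrary positive
numbers, so every rule for choosing them is covered; the stopping test (on the duality gap) decides
only how many passes are made, and `N` is arbitrary, so every stopping rule is covered too. -/
structure IsRun (S : Matrix (Fin p) (Fin p) ℝ) (ρ c : ℝ) (ζinit : ℕ → ℝ) (N : ℕ∞)
    (ζ : ℕ → ℝ) (Θ : ℕ → Matrix (Fin p) (Fin p) ℝ) : Prop where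
  backtrack_mem : c ∈ Set.Ioo (0 : ℝ) 1
  trial_pos : ∀ t : ℕ, (t : ℕ∞) < N → 0 < ζinit t
  start_posDef : (Θ 0).PosDef
  /-- Line search: `ζ t` is the largest accepted number among `c ^ j * ζinit t`, `j = 0, 1, …`. -/
  lineSearch : ∀ t : ℕ, (t : ℕ∞) < N →
    IsGreatest {z | (∃ j : ℕ, z = c ^ j * ζinit t) ∧ Accepts S ρ (Θ t) z} (ζ t)
  update : ∀ t : ℕ, (t : ℕ∞) < N → Θ (t + 1) = proxStep S ρ (ζ t) (Θ t)

end GISTA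

end

namespace GISTA

open Matrix

section MatrixLemmas

variable {p : ℕ} {A B : Matrix (Fin p) (Fin p) ℝ}

/-! ### Positive semidefinite matrices -/

/-! The lower bound is an invariant of a single step. Since `x + ζ / x ≥ α + ζ / α` for `x ≥ α` and
`0 ≤ ζ ≤ α²`, the matrix `X + ζ X⁻¹` stays above `α + ζ / α`. Subtracting `ζ S` costs at most `ζ
‖S‖₂` and thresholding at most `p ζ ρ`. These losses add up to exactly `ζ / α`, by the choice of `α`
(`posSemidef_proxStep_sub`).

The upper bound comes from nonexpansiveness. By first-order optimality the minimizer is a fixed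
point of every proximal step. Thresholding is 1-Lipschitz entrywise, and the gradient step is
1-Lipschitz in Frobenius norm above `α` (`frobNorm_gradStep_sub_le`). Hence the Frobenius distance
to the minimizer never exceeds its initial value, and it controls the largest eigenvalue.

For the final estimate, `IsSolution.alpha_le` and `IsSolution.specNorm_le_beta` put the minimizer
between `α` and `β`. So its difference from a starting point in the same interval lies between `±(β
- α)`. -/

lemma le_iff_posSemidef_sub : A ≤ B ↔ (B - A).PosSemidef := Iff.rfl

lemma PosSemidef.exists_symm_sqrt (hA : A.PosSemidef) :
    ∃ C : Matrix (Fin p) (Fin p) ℝ, Cᵀ = C ∧ C * C = A := by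
  refine ⟨CFC.sqrt A, ?_, CFC.sqrt_mul_sqrt_self A hA.nonneg⟩
  have h := (CFC.sqrt_nonneg A).posSemidef.isHermitian
  rwa [IsHermitian, conjTranspose_eq_transpose_of_trivial] at h

lemma IsHermitian.transpose_eq (hA : A.IsHermitian) : Aᵀ = A := by
  rwa [IsHermitian, conjTranspose_eq_transpose_of_trivial] at hA

lemma PosSemidef.transpose_mul_mul (hA : A.PosSemidef) (C : Matrix (Fin p) (Fin p) ℝ) :
    (Cᵀ * A * C).PosSemidef := by
  simpa [conjTranspose_eq_transpose_of_trivial] using hA.conjTranspose_mul_mul_same C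

lemma PosSemidef.mul_mul_of_isHermitian (hA : A.PosSemidef) (hB : B.IsHermitian) :
    (B * A * B).PosSemidef := by
  have h := PosSemidef.transpose_mul_mul hA B
  rwa [IsHermitian.transpose_eq hB] at h

lemma trace_mul_nonneg (hA : A.PosSemidef) (hB : B.PosSemidef) : 0 ≤ (A * B).trace := by
  obtain ⟨C, hC, rfl⟩ := PosSemidef.exists_symm_sqrt hB
  have h := (PosSemidef.transpose_mul_mul hA C).trace_nonneg
  rwa [hC, trace_mul_comm, ← mul_assoc, trace_mul_comm] at h

lemma PosDef.nonsing_inv_mul (hA : A.PosDef) : A⁻¹ * A = 1 :=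
  Matrix.nonsing_inv_mul A ((isUnit_iff_isUnit_det A).1 hA.isUnit)

lemma PosDef.mul_nonsing_inv (hA : A.PosDef) : A * A⁻¹ = 1 :=
  Matrix.mul_nonsing_inv A ((isUnit_iff_isUnit_det A).1 hA.isUnit)

lemma smul_one_posSemidef {a : ℝ} (ha : 0 ≤ a) :
    (a • (1 : Matrix (Fin p) (Fin p) ℝ)).PosSemidef := PosSemidef.one.smul ha

/-- If `a ≤ A` for positive definite `A` and `0 ≤ a`, then `a A⁻¹ ≤ 1`. -/
lemma one_sub_smul_inv_posSemidef (hA : A.PosDef) {a : ℝ} (ha : 0 ≤ a)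
    (h : (A - a • 1).PosSemidef) : (1 - a • A⁻¹).PosSemidef := by
  -- `A² - aA = (A - a)² + a(A - a)`, conjugated by `A⁻¹`.
  have h1 : (A⁻¹ * ((A - a • 1) * 1 * (A - a • 1) + a • (A - a • 1)) * A⁻¹).PosSemidef :=
    PosSemidef.mul_mul_of_isHermitian
      ((PosSemidef.mul_mul_of_isHermitian PosSemidef.one h.isHermitian).add (h.smul ha))
      hA.inv.isHermitian
  have e : A⁻¹ * ((A - a • 1) * 1 * (A - a • 1) + a • (A - a • 1)) * A⁻¹ = 1 - a • A⁻¹ := by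
    have e1 : (A - a • 1) * 1 * (A - a • 1) + a • (A - a • 1) = A * A - a • A := by
      simp only [mul_one, sub_mul, mul_sub, smul_mul_assoc, mul_smul_comm, one_mul, smul_sub]
      abel
    rw [e1, mul_sub, sub_mul, ← mul_assoc, PosDef.nonsing_inv_mul hA, one_mul,
      PosDef.mul_nonsing_inv hA, mul_smul_comm, smul_mul_assoc, PosDef.nonsing_inv_mul hA, one_mul]
  rwa [e] at h1

/-- If `A ≤ c` for positive definite `A` and `0 < c`, then `1 ≤ c A⁻¹`. -/
lemma smul_inv_sub_one_posSemidef (hA : A.PosDef) {c : ℝ} (hc : 0 < c)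
    (h : (c • 1 - A).PosSemidef) : (c • A⁻¹ - 1).PosSemidef := by
  -- Here `cA - A² = c⁻¹ (A(c - A)A + (c - A)A(c - A))`, a sum of congruences.
  have h1 : (A⁻¹ * (c⁻¹ • (A * (c • 1 - A) * A + (c • 1 - A) * A * (c • 1 - A))) *
      A⁻¹).PosSemidef :=
    PosSemidef.mul_mul_of_isHermitian
      (((PosSemidef.mul_mul_of_isHermitian h hA.isHermitian).add
        (PosSemidef.mul_mul_of_isHermitian hA.posSemidef h.isHermitian)).smul
          (inv_nonneg.2 hc.le)) hA.inv.isHermitian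
  have e1 : c⁻¹ • (A * (c • 1 - A) * A + (c • 1 - A) * A * (c • 1 - A)) = c • A - A * A := by
    rw [inv_smul_eq_iff₀ hc.ne']
    simp only [mul_one, sub_mul, mul_sub, smul_mul_assoc, mul_smul_comm, one_mul, smul_sub,
      mul_assoc]
    abel
  have e : A⁻¹ * (c • A - A * A) * A⁻¹ = c • A⁻¹ - 1 := by
    rw [mul_sub, sub_mul, ← mul_assoc A⁻¹ A A, PosDef.nonsing_inv_mul hA, one_mul,
      PosDef.mul_nonsing_inv hA, mul_smul_comm, smul_mul_assoc, PosDef.nonsing_inv_mul hA, one_mul]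
  rwa [e1, e] at h1

/-- The tangent plane inequality for the concave function `log det`. -/
lemma log_det_le (hA : A.PosDef) (hB : B.PosDef) :
    Real.log A.det ≤ Real.log B.det + (B⁻¹ * A).trace - p := by
  obtain ⟨C, hC, hCB⟩ := PosSemidef.exists_symm_sqrt hB.inv.posSemidef
  have hdetC : C.det * C.det = (B.det)⁻¹ := by
    rw [← det_mul, hCB, det_nonsing_inv, Ring.inverse_eq_inv']
  have hM : (C * A * C).PosSemidef := by
    have h := PosSemidef.transpose_mul_mul hA.posSemidef C
    rwa [hC] at h
  have hdet : (C * A * C).det = A.det * (B.det)⁻¹ := by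
    rw [det_mul, det_mul, ← hdetC]; ring
  have htr : (C * A * C).trace = (B⁻¹ * A).trace := by
    rw [trace_mul_comm, ← mul_assoc, hCB]
  have hpos : 0 < (C * A * C).det := by
    rw [hdet]; exact mul_pos hA.det_pos (inv_pos.2 hB.det_pos)
  -- Apply `log x ≤ x - 1` to each eigenvalue of `C A C`, where `C` is the square root of `B⁻¹`.
  have h1 : Real.log (C * A * C).det ≤ (C * A * C).trace - p := by
    have hd := hM.isHermitian.det_eq_prod_eigenvalues
    have ht := hM.isHermitian.trace_eq_sum_eigenvalues
    simp only [RCLike.ofReal_real_eq_id, id_eq] at hd ht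
    have hne : ∀ i ∈ Finset.univ, hM.isHermitian.eigenvalues i ≠ 0 := by
      rw [hd] at hpos
      exact Finset.prod_ne_zero_iff.1 hpos.ne'
    rw [hd, ht, Real.log_prod hne]
    calc _ ≤ ∑ i, (hM.isHermitian.eigenvalues i - 1) := by
          refine Finset.sum_le_sum fun i hi => Real.log_le_sub_one_of_pos ?_
          exact lt_of_le_of_ne (hM.eigenvalues_nonneg i) (hne i hi).symm
      _ = _ := by simp
  rw [hdet, htr, Real.log_mul hA.det_pos.ne' (inv_pos.2 hB.det_pos).ne', Real.log_inv] at h1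
  linarith

/-! ### Norms -/

lemma frobNorm_nonneg : 0 ≤ frobNorm A := Real.sqrt_nonneg _

lemma frobNorm_sq : frobNorm A ^ 2 = ∑ i, ∑ j, A i j ^ 2 :=
  Real.sq_sqrt (by positivity)

lemma frobNorm_sq_eq_trace : frobNorm A ^ 2 = (Aᵀ * A).trace := by
  rw [frobNorm_sq, Finset.sum_comm]
  simp [trace, mul_apply, sq]

lemma specNorm_nonneg : 0 ≤ specNorm A := norm_nonneg _

lemma l1Norm_nonneg : 0 ≤ l1Norm A :=
  Finset.sum_nonneg fun _ _ => Finset.sum_nonneg fun _ _ => abs_nonneg _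

lemma specNorm_le_frobNorm : specNorm A ≤ frobNorm A := by
  refine ContinuousLinearMap.opNorm_le_bound _ frobNorm_nonneg fun x => ?_
  refine (sq_le_sq₀ (norm_nonneg _) (mul_nonneg frobNorm_nonneg (norm_nonneg x))).1 ?_
  rw [mul_pow, frobNorm_sq, EuclideanSpace.norm_sq_eq, EuclideanSpace.norm_sq_eq, Finset.sum_mul]
  refine Finset.sum_le_sum fun i _ => ?_
  simp only [Real.norm_eq_abs, sq_abs, ofLp_toEuclideanCLM]
  exact Finset.sum_mul_sq_le_sq_mul_sq Finset.univ (fun j => A i j) (fun j => x j)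

lemma frobNorm_le_l1Norm : frobNorm A ≤ l1Norm A := by
  refine Real.sqrt_le_iff.2 ⟨l1Norm_nonneg, ?_⟩
  have h : ∀ i, ∑ j, A i j ^ 2 ≤ (∑ j, |A i j|) ^ 2 := fun i => by
    simpa using Finset.sum_sq_le_sq_sum_of_nonneg (s := Finset.univ) (f := fun j => |A i j|)
      (fun j _ => abs_nonneg _)
  refine (Finset.sum_le_sum fun i _ => h i).trans ?_
  exact Finset.sum_sq_le_sq_sum_of_nonneg (s := Finset.univ) (f := fun i => ∑ j, |A i j|)
    fun i _ => Finset.sum_nonneg fun j _ => abs_nonneg _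

lemma trace_le_l1Norm : A.trace ≤ l1Norm A :=
  Finset.sum_le_sum fun i _ => (le_abs_self _).trans
    (Finset.single_le_sum (f := fun j => |A i j|) (fun _ _ => abs_nonneg _) (Finset.mem_univ i))

lemma posSemidef_specNorm_sub (hA : A.IsHermitian) : (specNorm A • 1 - A).PosSemidef := by
  refine .of_dotProduct_mulVec_nonneg
    ((smul_one_posSemidef specNorm_nonneg).isHermitian.sub hA) fun x => ?_
  have h1 := real_inner_le_norm (WithLp.toLp 2 x)
    (toEuclideanCLM (n := Fin p) (𝕜 := ℝ) A (WithLp.toLp 2 x))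
  rw [inner_toEuclideanCLM] at h1
  have h2 := (toEuclideanCLM (n := Fin p) (𝕜 := ℝ) A).le_opNorm (WithLp.toLp 2 x)
  have h3 : ‖WithLp.toLp 2 x‖ ^ 2 = x ⬝ᵥ x := by
    rw [EuclideanSpace.norm_sq_eq]
    simp [dotProduct, sq]
  have h4 := mul_le_mul_of_nonneg_left h2 (norm_nonneg (WithLp.toLp 2 x))
  simp only [star_trivial, sub_mulVec, smul_mulVec, one_mulVec, dotProduct_sub, dotProduct_smul,
    smul_eq_mul, ← h3, specNorm]
  dsimp only at h1
  nlinarith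

lemma posSemidef_smul_one_sub_mono {a b : ℝ} (hab : a ≤ b) (h : (a • 1 - A).PosSemidef) :
    (b • 1 - A).PosSemidef := by
  have h2 := h.add (smul_one_posSemidef (p := p) (sub_nonneg.2 hab))
  convert h2 using 1
  rw [sub_smul]; abel

lemma posSemidef_frobNorm_sub (hA : A.IsHermitian) : (frobNorm A • 1 - A).PosSemidef :=
  posSemidef_smul_one_sub_mono specNorm_le_frobNorm (posSemidef_specNorm_sub hA)

lemma frobNorm_neg : frobNorm (-A) = frobNorm A := by
  simp [frobNorm]

lemma posSemidef_frobNorm_add (hA : A.IsHermitian) : (frobNorm A • 1 + A).PosSemidef := by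
  have h := posSemidef_frobNorm_sub hA.neg
  rwa [frobNorm_neg, sub_neg_eq_add] at h

/-- Entries of `A = C²` are inner products of rows of `C`. By Cauchy–Schwarz each squared entry is
at most a product of two diagonal entries, and these products sum to the squared trace. -/
lemma frobNorm_le_trace (hA : A.PosSemidef) : frobNorm A ≤ A.trace := by
  obtain ⟨C, hC, rfl⟩ := PosSemidef.exists_symm_sqrt hA
  refine Real.sqrt_le_iff.2 ⟨hA.trace_nonneg, ?_⟩
  have e : (C * C).trace = ∑ i, ∑ k, C i k ^ 2 := by
    rw [← frobNorm_sq, frobNorm_sq_eq_trace, hC]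
  rw [e, sq, Finset.sum_mul]
  refine Finset.sum_le_sum fun i _ => ?_
  rw [Finset.mul_sum]
  refine Finset.sum_le_sum fun j _ => ?_
  have hj : (C * C) i j = ∑ k, C i k * C j k := by
    conv_lhs => rw [← hC]
    rw [hC, mul_apply]
    refine Finset.sum_congr rfl fun k _ => ?_
    rw [← congrFun (congrFun hC j) k, transpose_apply]
  rw [hj]
  exact Finset.sum_mul_sq_le_sq_mul_sq _ _ _

/-- The other `p - 1` eigenvalues use up at least `(p - 1) a` of the trace. -/
lemma specNorm_le_of_posSemidef_sub {a : ℝ} (ha : 0 ≤ a) (h : (A - a • 1).PosSemidef) :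
    specNorm A ≤ A.trace - (p - 1) * a := by
  have h1 : specNorm A ≤ specNorm (A - a • 1) + a := by
    have e : A = (A - a • 1) + a • 1 := by abel
    have h2 : specNorm ((A - a • 1) + a • 1) ≤ specNorm (A - a • 1) + specNorm (a • 1 :
        Matrix (Fin p) (Fin p) ℝ) := by
      simp only [specNorm, map_add]; exact norm_add_le _ _
    have h3 : specNorm (a • 1 : Matrix (Fin p) (Fin p) ℝ) ≤ a := by
      refine ContinuousLinearMap.opNorm_le_bound _ ha fun x => ?_
      simp [norm_smul, abs_of_nonneg ha]
    rw [← e] at h2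
    linarith
  have h2 := specNorm_le_frobNorm.trans (frobNorm_le_trace h)
  rw [trace_sub, trace_smul, trace_one, Fintype.card_fin, smul_eq_mul] at h2
  linarith

/-- A symmetric matrix between `-c` and `c` has Frobenius norm at most `√p c`. -/
lemma frobNorm_le_sqrt_mul (hA : A.IsHermitian) {c : ℝ} (hc : 0 ≤ c)
    (h1 : (c • 1 - A).PosSemidef) (h2 : (c • 1 + A).PosSemidef) :
    frobNorm A ≤ Real.sqrt p * c := by
  have h := trace_mul_nonneg h1 h2
  have e : (c • 1 - A) * (c • 1 + A) = (c * c) • 1 - A * A := by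
    simp only [sub_mul, mul_add, smul_mul_assoc, mul_smul_comm, one_mul, mul_one]
    module
  rw [e, trace_sub, trace_smul, trace_one, Fintype.card_fin, smul_eq_mul] at h
  have h3 : frobNorm A ^ 2 = (A * A).trace := by
    rw [frobNorm_sq_eq_trace, IsHermitian.transpose_eq hA]
  refine (abs_le_of_sq_le_sq' ?_ (mul_nonneg (Real.sqrt_nonneg _) hc)).2
  rw [mul_pow, Real.sq_sqrt (Nat.cast_nonneg p), h3]
  linarith

/-- A positive definite matrix bounded below by `a` has Frobenius norm at least `√p a`. -/
lemma sqrt_mul_le_frobNorm {a : ℝ} (ha : 0 ≤ a) (h : (A - a • 1).PosSemidef) :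
    Real.sqrt p * a ≤ frobNorm A := by
  have hA : A.IsHermitian := by
    have := h.isHermitian.add (smul_one_posSemidef (p := p) ha).isHermitian
    simpa using this
  refine (abs_le_of_sq_le_sq' ?_ frobNorm_nonneg).2
  have h1 := trace_mul_nonneg h h
  have h2 := h.trace_nonneg
  have e : (A - a • 1) * (A - a • 1) = A * A - (2 * a) • A + (a * a) • 1 := by
    simp only [sub_mul, mul_sub, smul_mul_assoc, mul_smul_comm, one_mul, mul_one]
    module
  rw [e, trace_add, trace_sub, trace_smul, trace_smul, trace_one, Fintype.card_fin, smul_eq_mul,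
    smul_eq_mul] at h1
  rw [trace_sub, trace_smul, trace_one, Fintype.card_fin, smul_eq_mul] at h2
  rw [frobNorm_sq_eq_trace, IsHermitian.transpose_eq hA, mul_pow,
    Real.sq_sqrt (Nat.cast_nonneg p)]
  nlinarith

lemma frobNorm_le_of_abs_le {c : ℝ} (hc : 0 ≤ c) (h : ∀ i j, |A i j| ≤ c) :
    frobNorm A ≤ p * c := by
  refine Real.sqrt_le_iff.2 ⟨by positivity, ?_⟩
  calc ∑ i, ∑ j, A i j ^ 2 ≤ ∑ _i : Fin p, ∑ _j : Fin p, c ^ 2 :=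
        Finset.sum_le_sum fun i _ => Finset.sum_le_sum fun j _ => sq_le_sq' (abs_le.1 (h i j)).1
          (abs_le.1 (h i j)).2
    _ = (p * c) ^ 2 := by simp; ring

end MatrixLemmas

/-! ### Soft thresholding -/

/-- Soft thresholding of a real number. -/
noncomputable def soft (τ x : ℝ) : ℝ := Real.sign x * max (|x| - τ) 0

lemma soft_eq {τ : ℝ} (hτ : 0 ≤ τ) (x : ℝ) :
    (τ ≤ x ∧ soft τ x = x - τ) ∨ (|x| ≤ τ ∧ soft τ x = 0) ∨ (x ≤ -τ ∧ soft τ x = x + τ) := by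
  rcases le_total |x| τ with h | h
  · exact .inr (.inl ⟨h, by rw [soft, max_eq_right (by linarith), mul_zero]⟩)
  rcases lt_trichotomy x 0 with hx | rfl | hx
  · rw [abs_of_neg hx] at h
    refine .inr (.inr ⟨by linarith, ?_⟩)
    rw [soft, abs_of_neg hx, max_eq_left (by linarith), Real.sign_of_neg hx]; ring
  · rw [abs_zero] at h
    exact .inr (.inl ⟨by simpa using hτ, by simp [soft]⟩)
  · rw [abs_of_pos hx] at h
    refine .inl ⟨h, ?_⟩
    rw [soft, abs_of_pos hx, max_eq_left (by linarith), Real.sign_of_pos hx]; ring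

lemma abs_soft_sub_le {τ : ℝ} (hτ : 0 ≤ τ) (x : ℝ) : |soft τ x - x| ≤ τ := by
  rcases soft_eq hτ x with ⟨_, h⟩ | ⟨h1, h⟩ | ⟨_, h⟩ <;> rw [h]
  · simp [abs_of_nonneg hτ]
  · simpa using h1
  · simp [abs_of_nonneg hτ]

lemma abs_soft_sub_soft_le {τ : ℝ} (hτ : 0 ≤ τ) (x y : ℝ) :
    |soft τ x - soft τ y| ≤ |x - y| := by
  have h1 := le_abs_self (x - y)
  have h2 := neg_le_abs (x - y)
  rw [abs_le]
  rcases soft_eq hτ x with ⟨hx, h⟩ | ⟨hx, h⟩ | ⟨hx, h⟩ <;>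
  rcases soft_eq hτ y with ⟨hy, h'⟩ | ⟨hy, h'⟩ | ⟨hy, h'⟩ <;> rw [h, h'] <;>
  (try rw [abs_le] at hx) <;> (try rw [abs_le] at hy) <;> constructor <;> linarith

/-- The fixed points of a proximal step are characterized by the subgradient inequality. -/
lemma soft_add_eq_self {ρ ζ θ w : ℝ} (hρ : 0 ≤ ρ) (hζ : 0 ≤ ζ)
    (h : ∀ a, w * a ≤ ρ * (|θ + a| - |θ|)) : soft (ζ * ρ) (θ + ζ * w) = θ := by
  -- Testing `a = ±1` gives `|w| ≤ ρ`. Testing `a = -θ` forces `w = ρ sgn θ` when `θ ≠ 0`.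
  have hw1 : w ≤ ρ := by
    have h1 := h 1
    have h2 := abs_add_le θ 1
    rw [abs_one] at h2
    nlinarith
  have hw2 : -ρ ≤ w := by
    have h1 := h (-1)
    have h2 := abs_add_le θ (-1)
    rw [abs_neg, abs_one] at h2
    nlinarith
  have hneg := h (-θ)
  rw [add_neg_cancel, abs_zero] at hneg
  rcases lt_trichotomy θ 0 with hθ | rfl | hθ
  · have hw : w = -ρ := by
      rw [abs_of_neg hθ] at hneg
      nlinarith
    subst hw
    have hle : θ + ζ * -ρ < 0 := by nlinarith [mul_nonneg hζ hρ]
    rw [soft, Real.sign_of_neg hle, abs_of_neg hle, max_eq_left (by linarith)]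
    ring
  · have habs : |ζ * w| ≤ ζ * ρ := by
      rw [abs_mul, abs_of_nonneg hζ]
      exact mul_le_mul_of_nonneg_left (abs_le.2 ⟨hw2, hw1⟩) hζ
    rw [soft, zero_add, max_eq_right (by linarith), mul_zero]
  · have hw : w = ρ := by
      rw [abs_of_pos hθ] at hneg
      nlinarith
    subst hw
    have hle : 0 < θ + ζ * w := by nlinarith [mul_nonneg hζ hρ]
    rw [soft, Real.sign_of_pos hle, abs_of_pos hle, max_eq_left (by linarith)]
    ring

section

variable {p : ℕ} {S Θ X Y : Matrix (Fin p) (Fin p) ℝ} {ρ ζ : ℝ}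

lemma softThreshold_apply (τ : ℝ) (i j : Fin p) : softThreshold τ X i j = soft τ (X i j) := rfl

lemma frobNorm_softThreshold_sub_le {τ : ℝ} (hτ : 0 ≤ τ) :
    frobNorm (softThreshold τ X - softThreshold τ Y) ≤ frobNorm (X - Y) := by
  refine Real.sqrt_le_sqrt (Finset.sum_le_sum fun i _ => Finset.sum_le_sum fun j _ => ?_)
  simp only [Matrix.sub_apply, softThreshold_apply]
  exact sq_le_sq.2 (abs_soft_sub_soft_le hτ _ _)

/-! ### Optimality conditions -/

lemma continuousAt_inv_add_smul (hΘ : Θ.PosDef) (H : Matrix (Fin p) (Fin p) ℝ) :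
    ContinuousAt (fun t : ℝ => (Θ + t • H)⁻¹) 0 := by
  have hc : Continuous fun t : ℝ => Θ + t • H := by fun_prop
  simp only [inv_def, Ring.inverse_eq_inv']
  refine ContinuousAt.smul (ContinuousAt.inv₀ hc.matrix_det.continuousAt ?_)
    hc.matrix_adjugate.continuousAt
  simpa using hΘ.det_pos.ne'

/-- `Θ ≥ c⁻¹` and `H ≥ -‖H‖_F`, so any `t` with `t ‖H‖_F < c⁻¹` works. -/
lemma exists_posDef_add_smul (hΘ : Θ.PosDef) {H : Matrix (Fin p) (Fin p) ℝ}
    (hH : H.IsHermitian) : ∃ ε > (0 : ℝ), ∀ t, 0 < t → t < ε → (Θ + t • H).PosDef := by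
  set c := frobNorm Θ⁻¹ + 1 with hc
  have hc0 : 0 < c := by have := frobNorm_nonneg (A := Θ⁻¹); linarith
  have h1 := smul_inv_sub_one_posSemidef hΘ.inv hc0
    (posSemidef_smul_one_sub_mono (by linarith) (posSemidef_frobNorm_sub hΘ.inv.isHermitian))
  rw [nonsing_inv_nonsing_inv _ ((isUnit_iff_isUnit_det Θ).1 hΘ.isUnit)] at h1
  have hf := frobNorm_nonneg (A := H)
  refine ⟨(c * (frobNorm H + 1))⁻¹, by positivity, fun t ht0 ht => ?_⟩
  have hpos : 0 < c⁻¹ - t * frobNorm H := by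
    rw [mul_inv] at ht
    have h2 : t * (frobNorm H + 1) < c⁻¹ := by
      rwa [← lt_div_iff₀ (by positivity), div_eq_mul_inv]
    nlinarith
  have h3 := (PosDef.one (n := Fin p) (R := ℝ)).smul hpos
  have h4 := (h3.add_posSemidef (h1.smul (inv_nonneg.2 hc0.le))).add_posSemidef
    ((posSemidef_frobNorm_add hH).smul ht0.le)
  convert h4 using 1
  rw [smul_sub, inv_smul_smul₀ hc0.ne']
  module

lemma l1Norm_add_smul_le (H : Matrix (Fin p) (Fin p) ℝ) {t : ℝ} (h0 : 0 ≤ t) (h1 : t ≤ 1) :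
    l1Norm (Θ + t • H) ≤ l1Norm Θ + t * (l1Norm (Θ + H) - l1Norm Θ) := by
  have : l1Norm Θ + t * (l1Norm (Θ + H) - l1Norm Θ) =
      ∑ i, ∑ j, (|Θ i j| + t * (|Θ i j + H i j| - |Θ i j|)) := by
    simp only [l1Norm, Finset.sum_add_distrib, ← Finset.mul_sum, Finset.sum_sub_distrib, Matrix.add_apply]
  rw [this]
  refine Finset.sum_le_sum fun i _ => Finset.sum_le_sum fun j _ => ?_
  have e : (Θ + t • H) i j = (1 - t) * Θ i j + t * (Θ i j + H i j) := by
    simp only [Matrix.add_apply, Matrix.smul_apply, smul_eq_mul]; ring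
  rw [e]
  refine (abs_add_le _ _).trans ?_
  rw [abs_mul, abs_mul, abs_of_nonneg h0, abs_of_nonneg (sub_nonneg.2 h1)]
  linarith

/-- The subgradient inequality at a solution, in symmetric directions. -/
lemma IsSolution.trace_mul_le_of_isHermitian (hρ : 0 ≤ ρ) (h : IsSolution S ρ Θ)
    {H : Matrix (Fin p) (Fin p) ℝ} (hH : H.IsHermitian) :
    ((Θ⁻¹ - S) * H).trace ≤ ρ * (l1Norm (Θ + H) - l1Norm Θ) := by
  obtain ⟨ε, hε, hpd⟩ := exists_posDef_add_smul h.1 hH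
  have hlim : Filter.Tendsto (fun t : ℝ => ((Θ + t • H)⁻¹ * H).trace)
      (nhdsWithin 0 (Set.Ioi 0)) (nhds (Θ⁻¹ * H).trace) := by
    have hcont : ContinuousAt (fun t : ℝ => ((Θ + t • H)⁻¹ * H).trace) 0 := by
      have hcm : Continuous fun M : Matrix (Fin p) (Fin p) ℝ => (M * H).trace := by fun_prop
      exact hcm.continuousAt.comp (continuousAt_inv_add_smul h.1 H)
    have := hcont.tendsto
    simp only [zero_smul, add_zero] at this
    exact this.mono_left nhdsWithin_le_nhds
  have hle : (Θ⁻¹ * H).trace ≤ (S * H).trace + ρ * (l1Norm (Θ + H) - l1Norm Θ) := by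
    refine le_of_tendsto hlim ?_
    filter_upwards [Ioo_mem_nhdsGT (lt_min hε one_pos)] with t ht
    obtain ⟨ht0, ht1⟩ := ht
    have hX := hpd t ht0 (ht1.trans_le (min_le_left _ _))
    have hl1 := l1Norm_add_smul_le (Θ := Θ) H ht0.le (ht1.le.trans (min_le_right _ _))
    have hobj : objective S ρ Θ ≤ objective S ρ (Θ + t • H) := h.2 hX
    -- The tangent plane is taken at the perturbed point, so `log det` need not be differentiated:
    -- continuity of the inverse suffices as `t → 0`.
    have hlog := log_det_le h.1 hX
    have e : ((Θ + t • H)⁻¹ * Θ).trace = p - t * ((Θ + t • H)⁻¹ * H).trace := by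
      have e1 : Θ = (Θ + t • H) - t • H := by abel
      conv_lhs => rw [e1, mul_sub, ← e1, PosDef.nonsing_inv_mul hX]
      simp
    rw [e] at hlog
    simp only [objective, smoothPart, mul_add, trace_add, mul_smul_comm, trace_smul,
      smul_eq_mul] at hobj
    have h5 := mul_le_mul_of_nonneg_left hl1 hρ
    refine le_of_mul_le_mul_left ?_ ht0
    nlinarith
  rw [sub_mul, trace_sub]
  linarith

/-- The subgradient inequality at a solution. -/
lemma IsSolution.trace_mul_le (hρ : 0 ≤ ρ) (hS : S.IsHermitian) (h : IsSolution S ρ Θ)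
    (H : Matrix (Fin p) (Fin p) ℝ) :
    ((Θ⁻¹ - S) * H).trace ≤ ρ * (l1Norm (Θ + H) - l1Norm Θ) := by
  have hW : (Θ⁻¹ - S)ᵀ = Θ⁻¹ - S := IsHermitian.transpose_eq (h.1.inv.isHermitian.sub hS)
  have hΘ : Θᵀ = Θ := IsHermitian.transpose_eq h.1.isHermitian
  -- Only symmetric directions are feasible. Symmetrizing `H` keeps the trace, as `Θ⁻¹ - S` is
  -- symmetric, and does not increase the `ℓ₁` norm of `Θ + H`.
  have hK : ((1 / 2 : ℝ) • (H + Hᵀ)).IsHermitian := by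
    rw [IsHermitian, conjTranspose_eq_transpose_of_trivial, transpose_smul, transpose_add,
      transpose_transpose, add_comm]
  have h1 := h.trace_mul_le_of_isHermitian hρ hK
  have e1 : ((Θ⁻¹ - S) * Hᵀ).trace = ((Θ⁻¹ - S) * H).trace := by
    rw [← trace_transpose, transpose_mul, transpose_transpose, hW, trace_mul_comm]
  rw [mul_smul_comm, trace_smul, mul_add, trace_add, e1, smul_eq_mul] at h1
  have e2 : l1Norm (Θ + (1 / 2 : ℝ) • (H + Hᵀ)) ≤ l1Norm (Θ + H) := by
    have e3 : ∑ i, ∑ j, |(Θ + H) j i| = l1Norm (Θ + H) := Finset.sum_comm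
    have e4 : l1Norm (Θ + H) = ∑ i, ∑ j, (1 / 2 * |(Θ + H) i j| + 1 / 2 * |(Θ + H) j i|) := by
      simp only [Finset.sum_add_distrib, ← Finset.mul_sum, e3]
      simp only [l1Norm]; ring
    rw [e4]
    refine Finset.sum_le_sum fun i _ => Finset.sum_le_sum fun j _ => ?_
    have e5 : (Θ + (1 / 2 : ℝ) • (H + Hᵀ)) i j
        = 1 / 2 * (Θ + H) i j + 1 / 2 * (Θ + H) j i := by
      have : Θ j i = Θ i j := congrFun (congrFun hΘ i) j
      simp only [Matrix.add_apply, Matrix.smul_apply, smul_eq_mul, transpose_apply, this]; ring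
    rw [e5]
    refine (abs_add_le _ _).trans (le_of_eq ?_)
    rw [abs_mul, abs_mul, abs_of_pos (by norm_num : (0 : ℝ) < 1 / 2)]
  have := mul_le_mul_of_nonneg_left e2 hρ
  linarith

/-- The subgradient inequality at a solution, entry by entry. -/
lemma IsSolution.apply_mul_le (hρ : 0 ≤ ρ) (hS : S.IsHermitian) (h : IsSolution S ρ Θ)
    (i j : Fin p) (a : ℝ) :
    (Θ⁻¹ - S) i j * a ≤ ρ * (|Θ i j + a| - |Θ i j|) := by
  have hW : (Θ⁻¹ - S)ᵀ = Θ⁻¹ - S := IsHermitian.transpose_eq (h.1.inv.isHermitian.sub hS)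
  have h1 := h.trace_mul_le hρ hS (single i j a)
  rw [trace_mul_single] at h1
  have e : l1Norm (Θ + single i j a) - l1Norm Θ = |Θ i j + a| - |Θ i j| := by
    simp only [l1Norm, ← Finset.sum_sub_distrib]
    rw [Finset.sum_eq_single i, Finset.sum_eq_single j]
    · simp
    · intro b _ hb
      simp [hb.symm]
    · simp
    · intro b _ hb
      refine Finset.sum_eq_zero fun k _ => ?_
      simp [hb.symm]
    · simp
  rw [e, ← transpose_apply (Θ⁻¹ - S), hW] at h1
  simpa [mul_comm] using h1

lemma IsSolution.abs_apply_le (hρ : 0 ≤ ρ) (hS : S.IsHermitian) (h : IsSolution S ρ Θ)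
    (i j : Fin p) : |(Θ⁻¹ - S) i j| ≤ ρ := by
  have h1 := h.apply_mul_le hρ hS i j 1
  have h2 := h.apply_mul_le hρ hS i j (-1)
  have h3 := abs_add_le (Θ i j) 1
  have h4 := abs_add_le (Θ i j) (-1)
  rw [abs_neg] at h4
  rw [abs_one] at h3 h4
  rw [abs_le]
  constructor <;> nlinarith

/-- The duality gap vanishes at a solution. -/
lemma IsSolution.trace_add_l1Norm (hρ : 0 ≤ ρ) (hS : S.IsHermitian) (h : IsSolution S ρ Θ) :
    (S * Θ).trace + ρ * l1Norm Θ = p := by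
  have hΘ : Θᵀ = Θ := IsHermitian.transpose_eq h.1.isHermitian
  -- The directions `±Θ i j` give the two opposite inequalities.
  have h1 : ∀ i j, (Θ⁻¹ - S) i j * Θ j i = ρ * |Θ i j| := fun i j => by
    have h1 := h.apply_mul_le hρ hS i j (Θ i j)
    have h2 := h.apply_mul_le hρ hS i j (-Θ i j)
    rw [add_neg_cancel, abs_zero] at h2
    rw [← two_mul, abs_mul, abs_two] at h1
    have e : Θ j i = Θ i j := congrFun (congrFun hΘ i) j
    rw [e]
    linarith
  have h2 : ((Θ⁻¹ - S) * Θ).trace = ρ * l1Norm Θ := by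
    simp only [trace, diag_apply, mul_apply, h1, l1Norm, Finset.mul_sum]
  rw [sub_mul, PosDef.nonsing_inv_mul h.1, trace_sub, trace_one, Fintype.card_fin] at h2
  linarith

lemma IsSolution.proxStep_eq (hρ : 0 ≤ ρ) (hS : S.IsHermitian) (h : IsSolution S ρ Θ)
    (hζ : 0 ≤ ζ) : proxStep S ρ ζ Θ = Θ := by
  ext i j
  have h1 := soft_add_eq_self hρ hζ (h.apply_mul_le hρ hS i j)
  rw [proxStep, softThreshold_apply]
  convert h1 using 2
  simp only [Matrix.sub_apply, Matrix.smul_apply, smul_eq_mul]; ring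

/-! ### Bounds on the solution -/

lemma alpha_nonneg (hρ : 0 ≤ ρ) : 0 ≤ alpha S ρ := by
  have := specNorm_nonneg (A := S)
  unfold alpha
  positivity

lemma alpha_pos (hp : 0 < p) (hρ : 0 < ρ) : 0 < alpha S ρ := by
  have := specNorm_nonneg (A := S)
  unfold alpha
  positivity

/-- The entries of `Θ⁻¹ - S` are at most `ρ` in absolute value, hence `Θ⁻¹ ≤ ‖S‖₂ + pρ = α⁻¹`; then
invert. -/
lemma IsSolution.alpha_le (hp : 0 < p) (hρ : 0 < ρ) (hS : S.IsHermitian)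
    (h : IsSolution S ρ Θ) : (Θ - alpha S ρ • 1).PosSemidef := by
  have hα := alpha_pos (S := S) hp hρ
  have h1 := posSemidef_smul_one_sub_mono (frobNorm_le_of_abs_le hρ.le (h.abs_apply_le hρ.le hS))
    (posSemidef_frobNorm_sub (h.1.inv.isHermitian.sub hS))
  have h2 := h1.add (posSemidef_specNorm_sub hS)
  have e : ((p * ρ) • 1 - (Θ⁻¹ - S)) + (specNorm S • 1 - S)
      = (alpha S ρ)⁻¹ • (1 : Matrix (Fin p) (Fin p) ℝ) - Θ⁻¹ := by
    rw [alpha, one_div, inv_inv]; module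
  rw [e] at h2
  have h3 := smul_inv_sub_one_posSemidef h.1.inv (inv_pos.2 hα) h2
  rw [nonsing_inv_nonsing_inv _ ((isUnit_iff_isUnit_det Θ).1 h.1.isUnit)] at h3
  have h4 := h3.smul hα.le
  rwa [smul_sub, smul_inv_smul₀ hα.ne'] at h4

/-- The smooth part is minimized at the inverse of a positive definite `S`. -/
lemma smoothPart_inv_le (hS : S.PosDef) (hX : X.PosDef) :
    smoothPart S S⁻¹ ≤ smoothPart S X := by
  have h := log_det_le hX hS.inv
  rw [nonsing_inv_nonsing_inv _ ((isUnit_iff_isUnit_det S).1 hS.isUnit)] at h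
  rw [smoothPart, smoothPart, PosDef.mul_nonsing_inv hS, trace_one, Fintype.card_fin]
  linarith

lemma IsSolution.l1Norm_le_of_posDef (hρ : 0 < ρ) (hS : S.PosDef) (h : IsSolution S ρ Θ) :
    l1Norm Θ ≤ l1Norm S⁻¹ := by
  have h1 : objective S ρ Θ ≤ objective S ρ S⁻¹ := h.2 hS.inv
  have h2 := smoothPart_inv_le hS h.1
  rw [objective, objective] at h1
  exact le_of_mul_le_mul_left (by linarith) hρ

/-- With `T = S + (ρ/2) I`, the inverse `T⁻¹` minimizes the smooth part plus `(ρ/2) Tr`. Comparing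
`Θ` with `T⁻¹` leaves `(ρ/2) Tr Θ`, which half of the penalty absorbs; this explains the factor 2.
-/
lemma IsSolution.l1Norm_le (hρ : 0 < ρ) (hS : S.PosSemidef) (h : IsSolution S ρ Θ) :
    l1Norm Θ ≤ 2 * l1Norm (S + (ρ / 2) • (1 : Matrix (Fin p) (Fin p) ℝ))⁻¹
      - ((S + (ρ / 2) • (1 : Matrix (Fin p) (Fin p) ℝ))⁻¹).trace := by
  have hT : (S + (ρ / 2) • (1 : Matrix (Fin p) (Fin p) ℝ)).PosDef :=
    PosDef.posSemidef_add hS (PosDef.one.smul (half_pos hρ))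
  set T := S + (ρ / 2) • (1 : Matrix (Fin p) (Fin p) ℝ) with hTdef
  have e : ∀ X : Matrix (Fin p) (Fin p) ℝ,
      smoothPart T X = smoothPart S X + ρ / 2 * X.trace := fun X => by
    simp only [smoothPart, hTdef, add_mul, smul_mul_assoc, one_mul, trace_add, trace_smul,
      smul_eq_mul]
    ring
  have h1 : objective S ρ Θ ≤ objective S ρ T⁻¹ := h.2 hT.inv
  have h2 := smoothPart_inv_le hT h.1
  rw [e, e] at h2
  rw [objective, objective] at h1
  have h3 := mul_le_mul_of_nonneg_left (trace_le_l1Norm (A := Θ)) hρ.le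
  refine le_of_mul_le_mul_left ?_ hρ
  linarith

/-- Bound `‖Θ‖₂` by the trace, the trace by `‖S⁻¹‖₂ Tr(SΘ)`, and `Tr(SΘ) = p - ρ‖Θ‖₁` using `‖Θ‖₁ ≥
√p α`. -/
lemma IsSolution.specNorm_le_of_posDef (hp : 0 < p) (hρ : 0 < ρ) (hS : S.PosDef)
    (h : IsSolution S ρ Θ) :
    specNorm Θ ≤ (p - ρ * Real.sqrt p * alpha S ρ) * specNorm S⁻¹ - ((p : ℝ) - 1) * alpha S ρ := by
  have hα := alpha_nonneg (S := S) hρ.le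
  have hlow := h.alpha_le hp hρ hS.isHermitian
  have h1 := specNorm_le_of_posSemidef_sub hα hlow
  have h2 := (sqrt_mul_le_frobNorm hα hlow).trans frobNorm_le_l1Norm
  have h3 := h.trace_add_l1Norm hρ.le hS.isHermitian
  have h4 : Θ.trace ≤ specNorm S⁻¹ * (S * Θ).trace := by
    have hc : 0 < specNorm S⁻¹ := by
      have : Nonempty (Fin p) := ⟨⟨0, hp⟩⟩
      refine norm_pos_iff.2 fun h0 => ?_
      have h0' : S⁻¹ = 0 := (map_eq_zero_iff (toEuclideanCLM (n := Fin p) (𝕜 := ℝ)) (EquivLike.injective _)).1 h0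
      have := hS.inv.trace_pos
      rw [h0', trace_zero] at this
      exact this.false
    have h5 := smul_inv_sub_one_posSemidef hS.inv hc (posSemidef_specNorm_sub hS.inv.isHermitian)
    rw [nonsing_inv_nonsing_inv _ ((isUnit_iff_isUnit_det S).1 hS.isUnit)] at h5
    have h6 := trace_mul_nonneg h5 h.1.posSemidef
    rw [sub_mul, one_mul, smul_mul_assoc, trace_sub, trace_smul, smul_eq_mul] at h6
    linarith
  have h7 : (S * Θ).trace ≤ p - ρ * Real.sqrt p * alpha S ρ := by
    have := mul_le_mul_of_nonneg_left h2 hρ.le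
    linarith
  have h8 := mul_le_mul_of_nonneg_left h7 (specNorm_nonneg (A := S⁻¹))
  linarith

lemma IsSolution.specNorm_le_beta (hp : 0 < p) (hρ : 0 < ρ) (hS : S.PosSemidef)
    (h : IsSolution S ρ Θ) : specNorm Θ ≤ beta S ρ := by
  have hl1 : specNorm Θ ≤ l1Norm Θ := specNorm_le_frobNorm.trans frobNorm_le_l1Norm
  refine le_min ?_ ?_
  · rw [le_div_iff₀ hρ]
    have h1 := h.trace_add_l1Norm hρ.le hS.isHermitian
    have h2 := trace_mul_nonneg hS (h.alpha_le hp hρ hS.isHermitian)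
    rw [mul_sub, mul_smul_comm, mul_one, trace_sub, trace_smul, smul_eq_mul] at h2
    have h3 := mul_le_mul_of_nonneg_left hl1 hρ.le
    linarith
  · unfold gamma
    split_ifs with hpd
    · exact le_min (hl1.trans (h.l1Norm_le_of_posDef hρ hpd)) (h.specNorm_le_of_posDef hp hρ hpd)
    · exact hl1.trans (h.l1Norm_le hρ hS)

/-! ### Proximal gradient steps -/

lemma posSemidef_proxStep_sub (hp : 0 < p) (hρ : 0 < ρ) (hS : S.IsHermitian) (hX : X.PosDef)
    (hαX : (X - alpha S ρ • 1).PosSemidef) (hζ : 0 ≤ ζ) (hζα : ζ ≤ alpha S ρ ^ 2)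
    (hP : (proxStep S ρ ζ X).IsHermitian) :
    (proxStep S ρ ζ X - alpha S ρ • 1).PosSemidef := by
  have hα := alpha_pos (S := S) hp hρ
  have hinv : (alpha S ρ)⁻¹ = specNorm S + p * ρ := by rw [alpha, one_div, inv_inv]
  set α := alpha S ρ
  have hG : (X - ζ • (S - X⁻¹)).IsHermitian :=
    hX.isHermitian.sub (IsSelfAdjoint.smul (.all ζ) (hS.sub hX.inv.isHermitian))
  have hE := posSemidef_frobNorm_add (hP.sub hG)
  have hfrob : frobNorm (proxStep S ρ ζ X - (X - ζ • (S - X⁻¹))) ≤ p * (ζ * ρ) :=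
    frobNorm_le_of_abs_le (by positivity) fun i j => abs_soft_sub_le (by positivity) _
  have h1 := (PosSemidef.mul_mul_of_isHermitian hX.inv.posSemidef hαX.isHermitian)
  have e1 : (X - α • 1) * X⁻¹ * (X - α • 1) = X - (2 * α) • 1 + (α ^ 2) • X⁻¹ := by
    simp only [sub_mul, mul_sub, PosDef.mul_nonsing_inv hX, PosDef.nonsing_inv_mul hX,
      smul_mul_assoc, mul_smul_comm, one_mul, mul_one]
    module
  rw [e1] at h1
  -- Matrix form of the scalar inequality: `X + ζX⁻¹ - (α + ζ/α) = (X - α)X⁻¹(X - α) + (α - ζ/α)(1 -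
  -- αX⁻¹)`. The last coefficient is nonnegative because `ζ ≤ α²`.
  have h2 := (one_sub_smul_inv_posSemidef hX hα.le hαX).smul
    (a := α - ζ * α⁻¹) (by
      rw [sub_nonneg, ← div_eq_mul_inv, div_le_iff₀ hα]; nlinarith)
  have h3 := (posSemidef_specNorm_sub hS).smul hζ
  have h4 := (((hE.add (smul_one_posSemidef (sub_nonneg.2 hfrob))).add h1).add h2).add h3
  convert h4 using 1
  have e2 : (α - ζ * α⁻¹) * α = α ^ 2 - ζ := by field_simp
  rw [smul_sub (α - ζ * α⁻¹), smul_smul, e2, hinv]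
  module

/-- The gradient step is nonexpansive on matrices bounded below by `a` if `ζ ≤ a²`. -/
lemma frobNorm_gradStep_sub_le {a : ℝ} (ha : 0 < a) (hX : X.PosDef) (hY : Y.PosDef)
    (hαX : (X - a • 1).PosSemidef) (hαY : (Y - a • 1).PosSemidef) (hζ : 0 ≤ ζ) (hζα : ζ ≤ a ^ 2) :
    frobNorm ((X - ζ • (S - X⁻¹)) - (Y - ζ • (S - Y⁻¹))) ≤ frobNorm (X - Y) := by
  have hA := hX.inv
  have hB := hY.inv
  have hD : (X - Y).IsHermitian := hX.isHermitian.sub hY.isHermitian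
  have e : (X - ζ • (S - X⁻¹)) - (Y - ζ • (S - Y⁻¹)) =
      (X - Y) - ζ • (X⁻¹ * (X - Y) * Y⁻¹) := by
    rw [mul_sub, sub_mul, PosDef.nonsing_inv_mul hX, one_mul, mul_assoc,
      PosDef.mul_nonsing_inv hY, mul_one]
    module
  -- `Z⁻² ≤ a⁻¹ Z⁻¹`, used once on each side of `D`, yields `a² ‖ADB‖_F² ≤ Tr(DADB)`. Thus the cross
  -- term of `‖D - ζADB‖_F²` dominates the quadratic one.
  have contr : ∀ {Z : Matrix (Fin p) (Fin p) ℝ}, Z.PosDef → (Z - a • 1).PosSemidef →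
      (Z⁻¹ - a • (Z⁻¹ * Z⁻¹)).PosSemidef := fun {Z} hZ h => by
    have h1 := PosSemidef.mul_mul_of_isHermitian h hZ.inv.isHermitian
    rwa [mul_sub, sub_mul, PosDef.nonsing_inv_mul hZ, one_mul, mul_smul_comm, mul_one,
      smul_mul_assoc] at h1
  have hAA := contr hX hαX
  have hBB := contr hY hαY
  rw [e]
  set A := X⁻¹
  set B := Y⁻¹
  set D := X - Y
  have hAT := IsHermitian.transpose_eq hA.isHermitian
  have hBT := IsHermitian.transpose_eq hB.isHermitian
  have hDT := IsHermitian.transpose_eq hD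
  have hA2 : (A * A).PosSemidef := by
    simpa using PosSemidef.mul_mul_of_isHermitian PosSemidef.one hA.isHermitian
  have hB2 : (B * B).PosSemidef := by
    simpa using PosSemidef.mul_mul_of_isHermitian PosSemidef.one hB.isHermitian
  have q1 := trace_mul_nonneg hA2 (PosSemidef.mul_mul_of_isHermitian hB2 hD)
  have q2 := trace_mul_nonneg hAA (PosSemidef.mul_mul_of_isHermitian hB2 hD)
  have q3 := trace_mul_nonneg (PosSemidef.mul_mul_of_isHermitian hA.posSemidef hD) hBB
  have q4 := trace_mul_nonneg (PosSemidef.mul_mul_of_isHermitian hA.posSemidef hD) hB.posSemidef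
  have e1 : (A * (D * (B * B) * D)).trace = (D * A * D * (B * B)).trace := by
    rw [trace_mul_comm (D * A * D), ← mul_assoc A, trace_mul_comm _ D]
    rw [trace_mul_comm (B * B)]
    simp only [mul_assoc]
  rw [sub_mul, trace_sub, smul_mul_assoc, trace_smul, smul_eq_mul, e1] at q2
  rw [mul_sub, trace_sub, mul_smul_comm, trace_smul, smul_eq_mul] at q3
  have e2 : frobNorm (D - ζ • (A * D * B)) ^ 2 = frobNorm D ^ 2 - 2 * ζ * (D * A * D * B).trace
      + ζ ^ 2 * (A * A * (D * (B * B) * D)).trace := by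
    have c1 : (B * (D * (A * D))).trace = (D * (A * (D * B))).trace := by
      rw [trace_mul_comm]; simp only [mul_assoc]
    have c2 : (B * (D * (A * (A * (D * B))))).trace = (A * (A * (D * (B * (B * D))))).trace := by
      rw [trace_mul_comm]
      simp only [mul_assoc]
      rw [trace_mul_comm]
      simp only [mul_assoc]
    rw [frobNorm_sq_eq_trace, frobNorm_sq_eq_trace]
    simp only [transpose_sub, transpose_smul, transpose_mul, hAT, hBT, hDT, sub_mul, mul_sub,
      smul_mul_assoc, mul_smul_comm, trace_sub, trace_smul, smul_eq_mul, mul_assoc, c1, c2]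
    ring
  refine (sq_le_sq₀ frobNorm_nonneg frobNorm_nonneg).1 ?_
  rw [e2]
  have k1 : a ^ 2 * (A * A * (D * (B * B) * D)).trace ≤ (D * A * D * B).trace := by nlinarith
  have k2 : ζ * (A * A * (D * (B * B) * D)).trace ≤ (D * A * D * B).trace :=
    (mul_le_mul_of_nonneg_right hζα q1).trans k1
  nlinarith [mul_le_mul_of_nonneg_left k2 hζ, mul_nonneg hζ q4]

lemma IsSolution.frobNorm_proxStep_sub_le (hp : 0 < p) (hρ : 0 < ρ) (hS : S.IsHermitian)
    (h : IsSolution S ρ Θ) (hX : X.PosDef) (hαX : (X - alpha S ρ • 1).PosSemidef) (hζ : 0 ≤ ζ)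
    (hζα : ζ ≤ alpha S ρ ^ 2) : frobNorm (proxStep S ρ ζ X - Θ) ≤ frobNorm (X - Θ) := by
  conv_lhs => rw [← h.proxStep_eq hρ.le hS hζ]
  exact (frobNorm_softThreshold_sub_le (by positivity)).trans
    (frobNorm_gradStep_sub_le (alpha_pos hp hρ) hX h.1 hαX (h.alpha_le hp hρ hS) hζ hζα)

lemma IsRun.iterates {c : ℝ} {ζinit ζ : ℕ → ℝ} {N : ℕ∞} {Θs : ℕ → Matrix (Fin p) (Fin p) ℝ}
    (hrun : IsRun S ρ c ζinit N ζ Θs) (hp : 0 < p) (hρ : 0 < ρ) (hS : S.IsHermitian)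
    (h : IsSolution S ρ Θ) (hstart : (Θs 0 - alpha S ρ • 1).PosSemidef)
    (hζ : ∀ t : ℕ, (t : ℕ∞) < N → ζ t ≤ alpha S ρ ^ 2) (t : ℕ) (ht : (t : ℕ∞) ≤ N) :
    (Θs t).PosDef ∧ (Θs t - alpha S ρ • 1).PosSemidef ∧
      frobNorm (Θs t - Θ) ≤ frobNorm (Θs 0 - Θ) := by
  induction t with
  | zero => exact ⟨hrun.start_posDef, hstart, le_rfl⟩
  | succ t ih =>
    have htN : (t : ℕ∞) < N := lt_of_lt_of_le (by exact_mod_cast t.lt_succ_self) ht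
    obtain ⟨hpd, hlow, hfrob⟩ := ih htN.le
    obtain ⟨⟨j, hj⟩, hacc⟩ := (hrun.lineSearch t htN).1
    have hζ0 : 0 ≤ ζ t := by
      rw [hj]
      exact mul_nonneg (pow_nonneg hrun.backtrack_mem.1.le j) (hrun.trial_pos t htN).le
    rw [hrun.update t htN]
    exact ⟨hacc.1,
      posSemidef_proxStep_sub hp hρ hS hpd hlow hζ0 (hζ t htN) hacc.1.isHermitian,
      (h.frobNorm_proxStep_sub_le hp hρ hS hpd hlow hζ0 (hζ t htN)).trans hfrob⟩

end

end GISTA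

/-! ### Eigenvalue bounds for the iterates -/

theorem theorem2 {p : ℕ} (S : Matrix (Fin p) (Fin p) ℝ) (hS : S.PosSemidef)
    (ρ : ℝ) (hρ : 0 < ρ)
    (Θstar : Matrix (Fin p) (Fin p) ℝ) (hstar : GISTA.IsSolution S ρ Θstar)
    (c : ℝ) (ζinit : ℕ → ℝ) (N : ℕ∞) (ζ : ℕ → ℝ) (Θ : ℕ → Matrix (Fin p) (Fin p) ℝ)
    (hrun : GISTA.IsRun S ρ c ζinit N ζ Θ)
    (hstart : GISTA.alpha S ρ • (1 : Matrix (Fin p) (Fin p) ℝ) ≤ Θ 0)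
    (hζ : ∀ t : ℕ, (t : ℕ∞) < N → ζ t ≤ GISTA.alpha S ρ ^ 2) :
    (∀ t : ℕ, (t : ℕ∞) ≤ N →
      GISTA.alpha S ρ • (1 : Matrix (Fin p) (Fin p) ℝ) ≤ Θ t ∧
      Θ t ≤ (GISTA.specNorm Θstar + GISTA.frobNorm (Θ 0 - Θstar)) •
        (1 : Matrix (Fin p) (Fin p) ℝ)) ∧
    (Θ 0 ≤ GISTA.beta S ρ • (1 : Matrix (Fin p) (Fin p) ℝ) →
      GISTA.specNorm Θstar + GISTA.frobNorm (Θ 0 - Θstar) ≤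
        GISTA.beta S ρ + Real.sqrt p * (GISTA.beta S ρ + GISTA.alpha S ρ)) := by
  -- For `p = 0` the quotient defining `α` is `1 / 0 = 0`, so `α > 0` fails and this case is
  -- separate.
  obtain rfl | hp := p.eq_zero_or_pos
  · refine ⟨fun t _ => ⟨(Subsingleton.elim _ _).le, (Subsingleton.elim _ _).le⟩, fun _ => ?_⟩
    have hpd : S.PosDef := by
      rw [Subsingleton.elim S 1]; exact Matrix.PosDef.one
    have hs : ∀ A : Matrix (Fin 0) (Fin 0) ℝ, GISTA.specNorm A = 0 := fun A => by
      rw [Subsingleton.elim A 0]; simp [GISTA.specNorm]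
    simp [hs, GISTA.frobNorm, GISTA.beta, GISTA.gamma, GISTA.l1Norm, GISTA.alpha, hpd,
      Matrix.trace]
  have hSH := hS.isHermitian
  refine ⟨fun t ht => ?_, fun hβ => ?_⟩
  · obtain ⟨hpd, hlow, hfrob⟩ := hrun.iterates hp hρ hSH hstar hstart hζ t ht
    refine ⟨hlow, ?_⟩
    have h1 := GISTA.posSemidef_smul_one_sub_mono hfrob
      (GISTA.posSemidef_frobNorm_sub (hpd.isHermitian.sub hstar.1.isHermitian))
    have h2 := (GISTA.posSemidef_specNorm_sub hstar.1.isHermitian).add h1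
    refine GISTA.le_iff_posSemidef_sub.2 ?_
    convert h2 using 1
    module
  · have hspec := hstar.specNorm_le_beta hp hρ hS
    have hα := GISTA.alpha_pos (S := S) hp hρ
    have hup := GISTA.posSemidef_smul_one_sub_mono hspec
      (GISTA.posSemidef_specNorm_sub hstar.1.isHermitian)
    have hlow := hstar.alpha_le hp hρ hSH
    rw [GISTA.le_iff_posSemidef_sub] at hβ hstart
    -- Read off a diagonal entry of `(Θstar - α) + (β - Θstar) ≥ 0`.
    have hαβ : GISTA.alpha S ρ ≤ GISTA.beta S ρ := by
      have h1 := (hlow.add hup).diag_nonneg (i := ⟨0, hp⟩)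
      simp at h1
      linarith
    have h1 := GISTA.frobNorm_le_sqrt_mul
      (hrun.start_posDef.isHermitian.sub hstar.1.isHermitian) (sub_nonneg.2 hαβ)
      (by convert hβ.add hlow using 1; module) (by convert hstart.add hup using 1; module)
    -- The argument gives the sharper `√p (β - α)`, which is then weakened.
    have h2 := mul_le_mul_of_nonneg_left
      (by linarith : GISTA.beta S ρ - GISTA.alpha S ρ ≤ GISTA.beta S ρ + GISTA.alpha S ρ)
      (Real.sqrt_nonneg p)
    linarith
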